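/- **Setting.** A single origin--destination pair is joined by $R\ge 1$ parallel routes. Route $r$ has a travel time function $c^r:[0,\infty)\to\mathbb R$ that is continuous, strictly increasing and piecewise linear with $\eta\ge 1$ segments, $c^r(x)=c^{r,\beta}x+\alpha^{r,\beta}$ on $[x^{r,\beta},x^{r,\beta+1})$, where $0=x^{r,1}<\dots<x^{r,\eta}<x^{r,\eta+1}=\infty$, with free-flow travel time $\alpha^{r,1}=c^r(0)\ge 0$. For a demand $x\ge 0$ and a toll vector $u=(u^1,\dots,u^R)$, a user equilibrium is a pair $((x^r)_r,w)$ with $$x^r\ge 0,\qquad \sum_r x^r=x,\qquad c^r(x^r)+u^r-w\ge 0,\qquad x^r\bigl(c^r(x^r)+u^r-w\bigr)=0\qquad(1\le r\le R).$$ The total system travel time is $$TSTT(x,u)=\sum_{r\in\nu}(\alpha^{r,1}+u^r)+(R-|\nu|)\,w,\qquad \nu=\{r: x^r=0\},$$ which does not depend on the choice of the equilibrium. The congestion pricing Markov decision process has state space $S=\{0,1,2,\dots\}$ (the demand). The set $U(x)$ of actions in state $x$ is a nonempty set of toll vectors whose entries belong to a fixed finite set of positive toll values. For a given constant $\theta>0$,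 under action $u$ in state $i$ the next state is Poisson distributed with mean $\theta/TSTT(i,u)$; write $p_{ij}(u)$ for the transition probabilities. The expected cost per step is $g(i,u)=\sum_{j\in S}p_{ij}(u)\,TSTT(j,u)$. A feasible stationary policy is a map $\mu$ with $\mu(x)\in U(x)$ for all $x\in S$. For such a $\mu$, let $(x_k)_{k\ge 0}$ be the Markov chain with $x_0=0$ and transition probabilities $p_{ij}(\mu(i))$, let $T=\inf\{k\ge 1: x_k=0\}$ be the time of the first return to state $0$, and put $$N_\mu=E[T],\qquad C_\mu=E\Bigl[\sum_{k=0}^{T-1}g(x_k,\mu(x_k))\Bigr].$$ **Proposition.** For every feasible stationary policy $\mu$, both $C_\mu$ and $N_\mu$ are finite. Furthermore, $N_\mu$ is uniformly bounded over the policies: there is $\overline N>0$ (depending only on the decision process) such that $N_\mu<\overline N$ for all feasible stationary policies $\mu$. -/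

import Mathlib

open MeasureTheory ProbabilityTheory
open scoped NNReal ENNReal

noncomputable section

namespace CongestionPricing

/-- Raw data of a piecewise linear function on `[0, ∞)` with `η` segments: the left endpoint, the
slope and the intercept of each segment. -/
structure Segments (η : ℕ) where
  brk : Fin η → ℝ
  slope : Fin η → ℝ
  icpt : Fin η → ℝ

namespace Segments

variable {η : ℕ} (s : Segments η)

open Classical in
/-- The binary variable that indicates whether `x` lies on the segment `β`, i.e. in
`[brk β, brk (β + 1))`, respectively in `[brk β, ∞)` for the last segment. -/
def ind (β : Fin η) (x : ℝ) : ℝ :=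
  if s.brk β ≤ x ∧ ∀ h : (β : ℕ) + 1 < η, x < s.brk ⟨(β : ℕ) + 1, h⟩ then 1 else 0

/-- The value at `x` of the piecewise linear function. -/
def eval (x : ℝ) : ℝ := ∑ β, (s.slope β * x + s.icpt β) * s.ind β x

end Segments

/-- A continuous, increasing, piecewise linear travel time function on `[0, ∞)` with `η` segments,
the first of which starts at `0`, and with nonnegative free-flow travel time. -/
structure TravelTime (η : ℕ) extends Segments η where
  pos : 0 < η
  brk_first : brk ⟨0, pos⟩ = 0
  brk_strictMono : StrictMono brk
  continuousOn : ContinuousOn toSegments.eval (Set.Ici 0)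
  strictMonoOn : StrictMonoOn toSegments.eval (Set.Ici 0)
  icpt_first_nonneg : 0 ≤ icpt ⟨0, pos⟩

namespace TravelTime

variable {η : ℕ} (c : TravelTime η)

/-- The intercept of the first segment, i.e. the travel time of the empty route. -/
def freeFlow : ℝ := c.icpt ⟨0, c.pos⟩

theorem eval_zero : c.eval 0 = c.freeFlow := by
  unfold Segments.eval freeFlow
  rw [Finset.sum_eq_single ⟨0, c.pos⟩]
  · have : c.ind ⟨0, c.pos⟩ 0 = 1 := by
      unfold Segments.ind
      rw [if_pos]
      refine ⟨c.brk_first.le, fun h => ?_⟩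
      rw [← c.brk_first]
      exact c.brk_strictMono (by simp [Fin.lt_def])
    rw [this]; ring
  · intro β _ hβ
    have : c.ind β 0 = 0 := by
      unfold Segments.ind
      rw [if_neg]
      rintro ⟨h, -⟩
      have h1 : c.brk ⟨0, c.pos⟩ < c.brk β := c.brk_strictMono (by
        rw [Fin.lt_def]
        exact Nat.pos_of_ne_zero fun h0 => hβ (Fin.ext h0))
      rw [c.brk_first] at h1
      linarith
    rw [this]; ring
  · simp

theorem eval_of_last_le {y : ℝ} (hy : c.brk ⟨η - 1, Nat.sub_lt c.pos one_pos⟩ ≤ y) :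
    c.eval y = c.slope ⟨η - 1, Nat.sub_lt c.pos one_pos⟩ * y
      + c.icpt ⟨η - 1, Nat.sub_lt c.pos one_pos⟩ := by
  have hp := c.pos
  unfold Segments.eval
  rw [Finset.sum_eq_single ⟨η - 1, Nat.sub_lt c.pos one_pos⟩]
  · have : c.ind ⟨η - 1, Nat.sub_lt c.pos one_pos⟩ y = 1 := by
      unfold Segments.ind
      rw [if_pos]
      refine ⟨hy, fun h => ?_⟩
      simp only at h
      omega
    rw [this]; ring
  · intro β _ hβ
    have : c.ind β y = 0 := by
      unfold Segments.ind
      rw [if_neg]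
      rintro ⟨-, h⟩
      have hlt : (β : ℕ) + 1 < η := by
        have h1 := β.2
        have h2 : (β : ℕ) ≠ η - 1 := fun h0 => hβ (Fin.ext h0)
        omega
      have h1 := h hlt
      have h2 : c.brk ⟨(β : ℕ) + 1, hlt⟩ ≤ c.brk ⟨η - 1, Nat.sub_lt c.pos one_pos⟩ :=
        c.brk_strictMono.monotone (by
          rw [Fin.le_def]
          simp only
          omega)
      linarith
    rw [this]; ring
  · simp

theorem tendsto_eval : Filter.Tendsto c.eval Filter.atTop Filter.atTop := by
  set l : Fin η := ⟨η - 1, Nat.sub_lt c.pos one_pos⟩ with hl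
  have h0 : 0 ≤ c.brk l := by
    rw [← c.brk_first]
    exact c.brk_strictMono.monotone (by simp [Fin.le_def])
  have hs : 0 < c.slope l := by
    have h1 := c.strictMonoOn (Set.mem_Ici.2 h0) (Set.mem_Ici.2 (by linarith : 0 ≤ c.brk l + 1))
      (by linarith : c.brk l < c.brk l + 1)
    rw [c.eval_of_last_le le_rfl, c.eval_of_last_le (by rw [← hl]; linarith)] at h1
    simp only [← hl] at h1
    linarith
  have h2 : Filter.Tendsto (fun y => c.slope l * y + c.icpt l) Filter.atTop Filter.atTop :=
    Filter.tendsto_atTop_add_const_right _ _ (Filter.tendsto_id.const_mul_atTop hs)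
  refine h2.congr' ?_
  filter_upwards [Filter.eventually_ge_atTop (c.brk l)] with y hy
  exact (c.eval_of_last_le hy).symm

end TravelTime

/-- `R` parallel routes between one origin and one destination, with their travel time
functions. -/
structure Network where
  R : ℕ
  R_pos : 0 < R
  η : ℕ
  c : Fin R → TravelTime η

namespace Network

variable (net : Network)

/-- The user equilibrium conditions for total demand `x`, route tolls `u`, route flows `f` and
equilibrium travel time `w`: every route takes at least `w`, and exactly `w` if it carries flow. -/
structure IsEquilibrium (x : ℝ≥0) (u f : Fin net.R → ℝ) (w : ℝ) : Prop where
  compl : ∀ r, f r * ((net.c r).eval (f r) + u r - w) = 0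
  ge : ∀ r, 0 ≤ (net.c r).eval (f r) + u r - w
  sum_eq : ∑ r, f r = x
  nonneg : ∀ r, 0 ≤ f r

open Classical in
/-- The sum of the travel times of all routes: the free-flow travel time plus the toll for each
unused route, the equilibrium travel time for each used route. -/
def routeSum (u f : Fin net.R → ℝ) (w : ℝ) : ℝ :=
  ∑ r with f r = 0, ((net.c r).freeFlow + u r)
    + ((net.R : ℝ) - (Finset.univ.filter fun r => f r = 0).card) * w

theorem exists_equilibrium (x : ℝ≥0) (u : Fin net.R → ℝ) :
    ∃ p : (Fin net.R → ℝ) × ℝ, net.IsEquilibrium x u p.1 p.2 := by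
  have key : ∀ r, ∃ e : ℝ ≃o ℝ, ∀ y, 0 ≤ y → e y = (net.c r).eval y + u r := by
    intro r
    let G : ℝ → ℝ := fun y => (net.c r).eval (max y 0) + min y 0 + u r
    have hGm : StrictMono G := by
      intro a b hab
      have hmono := (net.c r).strictMonoOn
      have hmax : (net.c r).eval (max a 0) ≤ (net.c r).eval (max b 0) :=
        hmono.monotoneOn (Set.mem_Ici.2 (le_max_right _ _)) (Set.mem_Ici.2 (le_max_right _ _))
          (max_le_max_right 0 hab.le)
      have hmin : min a 0 ≤ min b 0 := min_le_min_right 0 hab.le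
      rcases le_or_gt 0 a with ha | ha
      · have : (net.c r).eval (max a 0) < (net.c r).eval (max b 0) := by
          rw [max_eq_left ha, max_eq_left (ha.trans hab.le)]
          exact hmono ha (ha.trans hab.le) hab
        simp only [G]
        linarith
      · have : min a 0 < min b 0 := by
          rw [min_eq_left ha.le]
          exact lt_min hab ha
        simp only [G]
        linarith
    have hGc : Continuous G := by
      have h1 : Continuous fun y : ℝ => (net.c r).eval (max y 0) :=
        (net.c r).continuousOn.comp_continuous (by fun_prop)
          (fun y => Set.mem_Ici.2 (le_max_right _ _))
      exact (h1.add (by fun_prop)).add continuous_const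
    have hTop : Filter.Tendsto G Filter.atTop Filter.atTop := by
      have h1 := Filter.tendsto_atTop_add_const_right _ (u r) (net.c r).tendsto_eval
      refine h1.congr' ?_
      filter_upwards [Filter.eventually_ge_atTop (0 : ℝ)] with y hy
      simp [G, max_eq_left hy, min_eq_right hy]
    have hBot : Filter.Tendsto G Filter.atBot Filter.atBot := by
      have h1 : Filter.Tendsto (fun y : ℝ => y + ((net.c r).eval 0 + u r)) Filter.atBot
          Filter.atBot := Filter.tendsto_atBot_add_const_right _ _ Filter.tendsto_id
      refine h1.congr' ?_
      filter_upwards [Filter.eventually_le_atBot (0 : ℝ)] with y hy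
      simp only [G, max_eq_right hy, min_eq_left hy]
      ring
    refine ⟨hGm.orderIsoOfSurjective G (hGc.surjective hTop hBot), fun y hy => ?_⟩
    simp [G, max_eq_left hy, min_eq_right hy]
  choose e he using key
  have : Nonempty (Fin net.R) := ⟨⟨0, net.R_pos⟩⟩
  let r0 : Fin net.R := ⟨0, net.R_pos⟩
  let S : ℝ → ℝ := fun w => ∑ r, max ((e r).symm w) 0
  have hS : Continuous S :=
    continuous_finsetSum _ fun r _ => (e r).symm.continuous.max continuous_const
  obtain ⟨w, hw⟩ : (x : ℝ) ∈ Set.range S := by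
    refine mem_range_of_exists_le_of_exists_ge hS
      ⟨Finset.univ.inf' Finset.univ_nonempty fun r => e r 0, ?_⟩ ⟨e r0 x, ?_⟩
    · have : S (Finset.univ.inf' Finset.univ_nonempty fun r => e r 0) = 0 := by
        refine Finset.sum_eq_zero fun r _ => max_eq_right ?_
        rw [OrderIso.symm_apply_le]
        exact Finset.inf'_le _ (Finset.mem_univ r)
      rw [this]
      exact x.2
    · calc (x : ℝ) ≤ max ((e r0).symm (e r0 x)) 0 := by simp
        _ ≤ S (e r0 x) := Finset.single_le_sum
          (f := fun r => max ((e r).symm (e r0 x)) 0) (fun r _ => le_max_right _ _)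
          (Finset.mem_univ r0)
  refine ⟨(fun r => max ((e r).symm w) 0, w), ?_, ?_, hw, fun r => le_max_right _ _⟩
  · intro r
    rcases le_or_gt ((e r).symm w) 0 with h | h
    · simp [max_eq_right h]
    · have h1 := he r _ h.le
      rw [OrderIso.apply_symm_apply] at h1
      simp only [max_eq_left h.le]
      rw [← h1]
      ring
  · intro r
    simp only
    rw [← he r _ (le_max_right _ _), sub_nonneg, ← OrderIso.symm_apply_le]
    exact le_max_left _ _

variable {net} in
theorem IsEquilibrium.routeSum_eq {x : ℝ≥0} {u f : Fin net.R → ℝ} {w : ℝ}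
    (h : net.IsEquilibrium x u f w) :
    net.routeSum u f w = ∑ r, ((net.c r).eval (f r) + u r) := by
  classical
  rw [← Finset.sum_filter_add_sum_filter_not Finset.univ (fun r => f r = 0)]
  unfold routeSum
  congr 1
  · refine Finset.sum_congr (by congr) fun r hr => ?_
    rw [(Finset.mem_filter.1 hr).2, TravelTime.eval_zero]
  · have h1 : ∀ r ∈ Finset.univ.filter (fun r => ¬ f r = 0), (net.c r).eval (f r) + u r = w := by
      intro r hr
      have := (mul_eq_zero.1 (h.compl r)).resolve_left (Finset.mem_filter.1 hr).2
      linarith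
    rw [Finset.sum_congr rfl h1, Finset.sum_const, nsmul_eq_mul]
    congr 1
    have h2 := Finset.card_filter_add_card_filter_not (s := (Finset.univ : Finset (Fin net.R)))
      (fun r => f r = 0)
    rw [Finset.card_univ, Fintype.card_fin] at h2
    have h3 : (net.R : ℝ) = (Finset.univ.filter fun r => f r = 0).card
        + (Finset.univ.filter fun r => ¬ f r = 0).card := by exact_mod_cast h2.symm
    rw [h3]
    have h4 : ∀ (p q : DecidablePred fun r => f r = 0),
        (@Finset.filter _ (fun r => f r = 0) p Finset.univ).card
          = (@Finset.filter _ (fun r => f r = 0) q Finset.univ).card := by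
      intro p q
      congr
    rw [h4 _ (fun r => Classical.propDecidable _)]
    ring

variable {net} in
theorem IsEquilibrium.flow_unique {x : ℝ≥0} {u f f' : Fin net.R → ℝ} {w w' : ℝ}
    (h : net.IsEquilibrium x u f w) (h' : net.IsEquilibrium x u f' w') : f = f' := by
  wlog hw : w ≤ w' generalizing f f' w w'
  · exact (this h' h (le_of_not_ge hw)).symm
  have hle : ∀ r, f r ≤ f' r := by
    intro r
    rcases eq_or_ne (f r) 0 with h0 | h0
    · rw [h0]
      exact h'.nonneg r
    · have h1 := (mul_eq_zero.1 (h.compl r)).resolve_left h0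
      have h2 := h'.ge r
      exact ((net.c r).strictMonoOn.le_iff_le (h.nonneg r) (h'.nonneg r)).1 (by linarith)
  funext r
  exact (Finset.sum_eq_sum_iff_of_le fun r _ => hle r).1 (h.sum_eq.trans h'.sum_eq.symm) r
    (Finset.mem_univ r)

/-- The total system travel time at demand `x` under the route tolls `u`. -/
def tstt (x : ℝ≥0) (u : Fin net.R → ℝ) : ℝ :=
  net.routeSum u (net.exists_equilibrium x u).choose.1 (net.exists_equilibrium x u).choose.2

/-- The total system travel time does not depend on the chosen equilibrium. -/
theorem tstt_eq {x : ℝ≥0} {u f : Fin net.R → ℝ} {w : ℝ} (h : net.IsEquilibrium x u f w) :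
    net.tstt x u = net.routeSum u f w := by
  have h' := (net.exists_equilibrium x u).choose_spec
  unfold tstt
  rw [h.routeSum_eq, h'.routeSum_eq, h'.flow_unique h]

theorem tstt_pos (x : ℝ≥0) {u : Fin net.R → ℝ} (hu : ∀ r, 0 < u r) : 0 < net.tstt x u := by
  obtain ⟨⟨f, w⟩, h⟩ := net.exists_equilibrium x u
  rw [net.tstt_eq h, h.routeSum_eq]
  have : Nonempty (Fin net.R) := ⟨⟨0, net.R_pos⟩⟩
  refine Finset.sum_pos (fun r _ => ?_) Finset.univ_nonempty
  have h1 : (net.c r).eval 0 ≤ (net.c r).eval (f r) :=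
    (net.c r).strictMonoOn.monotoneOn (Set.mem_Ici.2 le_rfl) (h.nonneg r) (h.nonneg r)
  rw [TravelTime.eval_zero] at h1
  have h2 : 0 ≤ (net.c r).freeFlow := (net.c r).icpt_first_nonneg
  linarith [hu r]

end Network

/-- The congestion pricing Markov decision process. A state is a demand in `ℕ`; the actions that
are admissible in a state are toll vectors with entries in a finite set of positive toll values. -/
structure PricingMDP extends Network where
  tolls : Finset ℝ
  tolls_pos : ∀ t ∈ tolls, 0 < t
  U : ℕ → Set (Fin R → ℝ)
  U_nonempty : ∀ x, (U x).Nonempty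
  U_tolls : ∀ x, ∀ u ∈ U x, ∀ r, u r ∈ tolls
  θ : ℝ
  θ_pos : 0 < θ

namespace PricingMDP

variable (M : PricingMDP)

/-- The mean demand of the next day, `θ / TSTT(x, u)` (a positive number for positive tolls). -/
def rate (x : ℕ) (u : Fin M.R → ℝ) : ℝ≥0 := (M.θ / M.tstt x u).toNNReal

/-- The law of the next state, given the state `x` and the action `u`: a Poisson distribution. -/
def step (x : ℕ) (u : Fin M.R → ℝ) : Measure ℕ := poissonMeasure (M.rate x u)

/-- The expected cost per time step `∑ⱼ p_{xj}(u) TSTT(j, u)`, as an element of `[0, ∞]`. -/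
def cost (x : ℕ) (u : Fin M.R → ℝ) : ℝ≥0∞ :=
  ∑' j : ℕ, M.step x u {j} * ENNReal.ofReal (M.tstt j u)

/-- A feasible stationary policy. -/
def Feasible (μ : ℕ → Fin M.R → ℝ) : Prop := ∀ x, μ x ∈ M.U x

/-- The one-step transition kernel of the Markov chain of the stationary policy `μ`. -/
def transition (μ : ℕ → Fin M.R → ℝ) : Kernel ℕ ℕ :=
  Kernel.ofFunOfCountable fun x => M.step x (μ x)

instance (μ : ℕ → Fin M.R → ℝ) : IsMarkovKernel (M.transition μ) :=
  ⟨fun x => inferInstanceAs (IsProbabilityMeasure (poissonMeasure (M.rate x (μ x))))⟩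

/-- The law on the space of trajectories `ℕ → ℕ` of the Markov chain of the stationary policy `μ`
that starts in the state `0`. -/
def chainLaw (μ : ℕ → Fin M.R → ℝ) : Measure (ℕ → ℕ) :=
  Kernel.trajMeasure (X := fun _ : ℕ => ℕ) (Measure.dirac 0)
    fun n => (M.transition μ).comap
      (fun h : (i : Finset.Iic n) → ℕ => h ⟨n, Finset.mem_Iic.2 le_rfl⟩) (measurable_pi_apply _)

/-- The first time `n ≥ 1` at which the trajectory is in the state `0` (`⊤` if there is none). -/
def returnTime (ω : ℕ → ℕ) : ℕ∞ := ⨅ (n : ℕ) (_ : 1 ≤ n ∧ ω n = 0), (n : ℕ∞)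

/-- The expected number `N_μ` of time steps to return to the state `0` from the state `0`. -/
def meanReturn (μ : ℕ → Fin M.R → ℝ) : ℝ≥0∞ :=
  ∫⁻ ω, (returnTime ω : ℝ≥0∞) ∂(M.chainLaw μ)

/-- The expected cost `C_μ` from the state `0` up to the first return to the state `0`, the sum of
the one-step costs at the times before the return. -/
def meanCost (μ : ℕ → Fin M.R → ℝ) : ℝ≥0∞ :=
  ∫⁻ ω, ∑' k : ℕ, {k : ℕ | (k : ℕ∞) < returnTime ω}.indicator
    (fun k => M.cost (ω k) (μ (ω k))) k ∂(M.chainLaw μ)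

end PricingMDP

end CongestionPricing

end

/-!
All tolls come from a finite set of positive values, so the total system travel time is bounded
below by a constant, and the Poisson means `θ / TSTT` are bounded above by some `Λ`
(`PricingMDP.exists_rate_le`). Hence every transition leads to the state `0` with probability at
least `exp (-Λ)`, whatever the current state and the action. The probability that the chain avoids
`0` at the times `1, …, k` is therefore at most `(1 - exp (-Λ)) ^ k`
(`PricingMDP.chainLaw_avoid_le`), and summing over `k` gives `N_μ ≤ exp Λ`.

The travel time functions grow at most linearly and each route carries at most the whole demand, so
`TSTT(j, u) ≤ B (j + 1)` with `B` independent of `u` (`PricingMDP.exists_tstt_le`). As the Poisson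
means are bounded, the one-step costs are bounded by a constant `K < ∞`
(`PricingMDP.exists_cost_le`), and `C_μ ≤ K N_μ` holds trajectory by trajectory.
-/

open MeasureTheory ProbabilityTheory
open scoped NNReal ENNReal

namespace CongestionPricing

/-! ### Bounds on the travel times -/

namespace TravelTime

/-- A travel time function grows at most linearly. -/
theorem eval_le {η : ℕ} (c : TravelTime η) {x : ℝ} (hx : 0 ≤ x) :
    c.eval x ≤ (∑ β, (|c.slope β| + |c.icpt β|)) * (x + 1) := by
  rw [Finset.sum_mul]
  refine Finset.sum_le_sum fun β _ => ?_
  have h1 := mul_le_mul_of_nonneg_right (le_abs_self (c.slope β)) hx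
  have h2 := le_abs_self (c.icpt β)
  have h3 := abs_nonneg (c.slope β)
  have h4 := mul_nonneg (abs_nonneg (c.icpt β)) hx
  have h5 := mul_nonneg h3 hx
  have h6 := abs_nonneg (c.icpt β)
  unfold Segments.ind
  split_ifs <;> nlinarith

end TravelTime

namespace PricingMDP

variable (M : PricingMDP)

theorem exists_le_tstt :
    ∃ m : ℝ, 0 < m ∧ ∀ x, ∀ u ∈ M.U x, ∀ j : ℝ≥0, m ≤ M.tstt j u := by
  let r₀ : Fin M.R := ⟨0, M.R_pos⟩
  have hne : M.tolls.Nonempty := by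
    obtain ⟨u, hu⟩ := M.U_nonempty 0
    exact ⟨_, M.U_tolls 0 u hu r₀⟩
  refine ⟨M.tolls.min' hne, M.tolls_pos _ (M.tolls.min'_mem hne), fun x u hu j => ?_⟩
  obtain ⟨⟨f, w⟩, h⟩ := M.toNetwork.exists_equilibrium j u
  rw [M.toNetwork.tstt_eq h, h.routeSum_eq]
  have hnn : ∀ r, 0 ≤ (M.c r).eval (f r) := fun r => by
    have h1 := (M.c r).strictMonoOn.monotoneOn (Set.mem_Ici.2 le_rfl) (h.nonneg r) (h.nonneg r)
    rw [TravelTime.eval_zero] at h1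
    exact (M.c r).icpt_first_nonneg.trans h1
  have hu0 : ∀ r, 0 < u r := fun r => M.tolls_pos _ (M.U_tolls x u hu r)
  calc M.tolls.min' hne ≤ u r₀ := M.tolls.min'_le _ (M.U_tolls x u hu r₀)
    _ ≤ (M.c r₀).eval (f r₀) + u r₀ := le_add_of_nonneg_left (hnn r₀)
    _ ≤ ∑ r, ((M.c r).eval (f r) + u r) := Finset.single_le_sum
        (f := fun r => (M.c r).eval (f r) + u r)
        (fun r _ => add_nonneg (hnn r) (hu0 r).le) (Finset.mem_univ r₀)

/-- The total system travel time grows at most linearly in the demand, uniformly over the tolls. -/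
theorem exists_tstt_le :
    ∃ B : ℝ, 0 ≤ B ∧ ∀ x, ∀ u ∈ M.U x, ∀ j : ℝ≥0, M.tstt j u ≤ B * (j + 1) := by
  -- All tolls are positive, so their sum bounds each of them.
  have hsum : 0 ≤ ∑ t ∈ M.tolls, t := Finset.sum_nonneg fun t ht => (M.tolls_pos t ht).le
  refine ⟨∑ r, ((∑ β, (|(M.c r).slope β| + |(M.c r).icpt β|)) + ∑ t ∈ M.tolls, t),
    by positivity, fun x u hu j => ?_⟩
  obtain ⟨⟨f, w⟩, h⟩ := M.toNetwork.exists_equilibrium j u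
  rw [M.toNetwork.tstt_eq h, h.routeSum_eq, Finset.sum_mul]
  refine Finset.sum_le_sum fun r _ => ?_
  have hf : f r ≤ j := by
    rw [← h.sum_eq]
    exact Finset.single_le_sum (fun r _ => h.nonneg r) (Finset.mem_univ r)
  have h1 : (M.c r).eval (f r) ≤ (M.c r).eval j :=
    (M.c r).strictMonoOn.monotoneOn (Set.mem_Ici.2 (h.nonneg r)) (Set.mem_Ici.2 j.2) hf
  have h2 := (M.c r).eval_le j.coe_nonneg
  have h3 : u r ≤ ∑ t ∈ M.tolls, t :=
    Finset.single_le_sum (f := fun t => t) (fun t ht => (M.tolls_pos t ht).le) (M.U_tolls x u hu r)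
  have h4 : ∑ t ∈ M.tolls, t ≤ (∑ t ∈ M.tolls, t) * ((j : ℝ) + 1) :=
    le_mul_of_one_le_right hsum (by simp)
  rw [add_mul]
  exact add_le_add (h1.trans h2) (h3.trans h4)

/-! ### Bounds on the transition probabilities and the one-step costs -/

theorem exists_rate_le : ∃ Λ : ℝ≥0, ∀ x, ∀ u ∈ M.U x, M.rate x u ≤ Λ := by
  obtain ⟨m, hm, h⟩ := M.exists_le_tstt
  refine ⟨(M.θ / m).toNNReal, fun x u hu => Real.toNNReal_le_toNNReal ?_⟩
  exact div_le_div_of_nonneg_left M.θ_pos.le hm (by simpa using h x u hu x)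

theorem step_compl_zero_le {Λ : ℝ≥0} {x : ℕ} {u : Fin M.R → ℝ} (h : M.rate x u ≤ Λ) :
    M.step x u {0}ᶜ ≤ 1 - ENNReal.ofReal (Real.exp (-Λ)) := by
  have : IsProbabilityMeasure (M.step x u) :=
    inferInstanceAs (IsProbabilityMeasure (poissonMeasure (M.rate x u)))
  rw [prob_compl_eq_one_sub (measurableSet_singleton 0)]
  refine tsub_le_tsub_left ?_ 1
  rw [step, poissonMeasure_singleton]
  refine ENNReal.ofReal_le_ofReal ?_
  simpa using h

/-- The expected one-step costs are finite, uniformly over the states and the admissible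
actions. -/
theorem exists_cost_le : ∃ K : ℝ≥0∞, K ≠ ∞ ∧ ∀ x, ∀ u ∈ M.U x, M.cost x u ≤ K := by
  obtain ⟨Λ, hΛ⟩ := M.exists_rate_le
  obtain ⟨B, hB, hT⟩ := M.exists_tstt_le
  refine ⟨∑' j : ℕ, ENNReal.ofReal ((2 * Λ : ℝ) ^ j / j.factorial * B),
    ((Real.summable_pow_div_factorial _).mul_right B).tsum_ofReal_ne_top, fun x u hu => ?_⟩
  refine ENNReal.tsum_le_tsum fun j => ?_
  rw [step, poissonMeasure_singleton, ← ENNReal.ofReal_mul (by positivity)]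
  refine ENNReal.ofReal_le_ofReal ?_
  have hr : (M.rate x u : ℝ) ≤ Λ := hΛ x u hu
  have h1 : Real.exp (-(M.rate x u : ℝ)) * (M.rate x u : ℝ) ^ j / j.factorial
      ≤ (Λ : ℝ) ^ j / j.factorial := by
    gcongr
    calc Real.exp (-(M.rate x u : ℝ)) * (M.rate x u : ℝ) ^ j ≤ 1 * (Λ : ℝ) ^ j := by
          gcongr
          simp
      _ = (Λ : ℝ) ^ j := one_mul _
  have h2 : M.tstt j u ≤ B * 2 ^ j := by
    have h3 : (j : ℝ) + 1 ≤ 2 ^ j := by exact_mod_cast Nat.lt_two_pow_self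
    refine (hT x u hu j).trans (mul_le_mul_of_nonneg_left ?_ hB)
    simpa using h3
  calc _ ≤ (Λ : ℝ) ^ j / j.factorial * (B * 2 ^ j) :=
        mul_le_mul h1 h2 (M.tstt_pos j fun r => M.tolls_pos _ (M.U_tolls x u hu r)).le
          (by positivity)
    _ = _ := by rw [mul_pow]; ring

/-! ### The return time -/

theorem lt_returnTime_iff {k : ℕ} {ω : ℕ → ℕ} :
    (k : ℕ∞) < returnTime ω ↔ ∀ i, 1 ≤ i → i ≤ k → ω i ≠ 0 := by
  rw [← ENat.add_one_le_iff (ENat.natCast_ne_top k), returnTime, le_iInf₂_iff]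
  refine ⟨fun h i h1 hik h0 => ?_, fun h n hn => ?_⟩
  · have := h i ⟨h1, h0⟩
    norm_cast at this
    omega
  · have : ¬ n ≤ k := fun hnk => h n hn.1 hnk hn.2
    norm_cast
    omega

theorem setOf_lt_returnTime_succ (k : ℕ) :
    {ω | ((k + 1 : ℕ) : ℕ∞) < returnTime ω} =
      {ω | (k : ℕ∞) < returnTime ω} ∩ {ω | ω (k + 1) ≠ 0} := by
  ext ω
  simp only [Set.mem_ofPred_eq, Set.mem_inter_iff, lt_returnTime_iff]
  refine ⟨fun h => ⟨fun i h1 h2 => h i h1 (by omega), h _ (by omega) le_rfl⟩,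
    fun h i h1 h2 => ?_⟩
  rcases Nat.lt_or_ge k i with hk | hk
  · obtain rfl : i = k + 1 := by omega
    exact h.2
  · exact h.1 i h1 hk

theorem measurableSet_lt_returnTime (k : ℕ) :
    MeasurableSet {ω : ℕ → ℕ | (k : ℕ∞) < returnTime ω} := by
  induction k with
  | zero =>
    convert MeasurableSet.univ
    exact Set.eq_univ_of_forall fun ω => (lt_returnTime_iff (k := 0)).2 fun i h1 h0 => by omega
  | succ k ih =>
    rw [setOf_lt_returnTime_succ]
    exact ih.inter (measurable_pi_apply (k + 1) (MeasurableSet.of_discrete (s := {0}ᶜ)))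

/-- An extended natural number is the number of the natural numbers below it. -/
theorem tsum_indicator_lt (n : ℕ∞) :
    ∑' k : ℕ, {k : ℕ | (k : ℕ∞) < n}.indicator (fun _ => (1 : ℝ≥0∞)) k = n := by
  induction n using ENat.recTopCoe with
  | top => simp
  | coe n =>
    rw [tsum_eq_sum (s := Finset.range n) fun k hk => by simpa using hk]
    rw [Finset.sum_congr rfl fun k hk => Set.indicator_of_mem (by simpa using hk) _]
    simp

/-- If each transition leads to the state `0` with probability at least `1 - q`, then the trajectory
avoids `0` at the times `1, …, k` with probability at most `q ^ k`: conditionally on the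
trajectory up to time `k`, the next state is distributed according to the transition kernel. -/
theorem chainLaw_avoid_le {μ : ℕ → Fin M.R → ℝ} {q : ℝ≥0∞}
    (hq : ∀ x, M.step x (μ x) {0}ᶜ ≤ q) (k : ℕ) :
    M.chainLaw μ {ω | (k : ℕ∞) < returnTime ω} ≤ q ^ k := by
  induction k with
  | zero =>
    have : IsProbabilityMeasure (M.chainLaw μ) := by unfold chainLaw; infer_instance
    simpa using prob_le_one
  | succ k ih =>
    -- The event that `0` is avoided up to time `k`, in terms of the first `k + 1` coordinates.
    let A : Set ((i : Finset.Iic k) → ℕ) := {h | ∀ i, 1 ≤ i.1 → h i ≠ 0}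
    have hA : MeasurableSet A := MeasurableSet.of_discrete
    have hAeq : Preorder.frestrictLe (π := fun _ => ℕ) k ⁻¹' A
        = {ω | (k : ℕ∞) < returnTime ω} := by
      ext ω
      simp [A, lt_returnTime_iff]
      grind
    have hmap : (M.chainLaw μ).map (Preorder.frestrictLe k) A
        = M.chainLaw μ {ω | (k : ℕ∞) < returnTime ω} := by
      rw [Measure.map_apply (by fun_prop) hA, hAeq]
    have hS : MeasurableSet ({0}ᶜ : Set ℕ) := MeasurableSet.of_discrete
    have key := congrArg (fun ν => ν (A ×ˢ ({0}ᶜ : Set ℕ)))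
      (Kernel.map_frestrictLe_trajMeasure_compProd_eq_map_trajMeasure
        (X := fun _ : ℕ => ℕ) (μ₀ := Measure.dirac 0)
        (κ := fun n => (M.transition μ).comap
          (fun h : (i : Finset.Iic n) → ℕ => h ⟨n, Finset.mem_Iic.2 le_rfl⟩)
          (measurable_pi_apply _)) (a := k))
    change ((M.chainLaw μ).map (Preorder.frestrictLe k) ⊗ₘ _) _ = (M.chainLaw μ).map _ _ at key
    rw [Measure.compProd_apply_prod hA hS, Measure.map_apply (by fun_prop) (hA.prod hS)] at key
    have hev : {ω | ((k + 1 : ℕ) : ℕ∞) < returnTime ω}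
        = (fun x : ℕ → ℕ => (Preorder.frestrictLe (π := fun _ => ℕ) k x, x (k + 1))) ⁻¹'
          (A ×ˢ ({0}ᶜ : Set ℕ)) := by
      rw [setOf_lt_returnTime_succ, ← hAeq]
      rfl
    rw [hev, ← key]
    calc _ ≤ ∫⁻ _ in A, q ∂((M.chainLaw μ).map (Preorder.frestrictLe k)) :=
          lintegral_mono fun h => hq _
      _ = q * M.chainLaw μ {ω | (k : ℕ∞) < returnTime ω} := by
          rw [setLIntegral_const, hmap]
      _ ≤ q * q ^ k := by gcongr
      _ = q ^ (k + 1) := (pow_succ' q k).symm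

/-! ### Mean return time and mean cost -/

/-- The return time is dominated by a geometric variable with success probability `1 - q`. -/
theorem meanReturn_le {μ : ℕ → Fin M.R → ℝ} {q : ℝ≥0∞}
    (hq : ∀ x, M.step x (μ x) {0}ᶜ ≤ q) : M.meanReturn μ ≤ (1 - q)⁻¹ := by
  calc M.meanReturn μ
      = ∫⁻ ω, ∑' k : ℕ, {ω : ℕ → ℕ | (k : ℕ∞) < returnTime ω}.indicator (fun _ => 1) ω
          ∂(M.chainLaw μ) := by
        refine lintegral_congr fun ω => ?_
        rw [← tsum_indicator_lt]
        rfl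
    _ = ∑' k : ℕ, M.chainLaw μ {ω | (k : ℕ∞) < returnTime ω} := by
        rw [lintegral_tsum fun k =>
          (measurable_const.indicator (measurableSet_lt_returnTime k)).aemeasurable]
        exact tsum_congr fun k => lintegral_indicator_one (measurableSet_lt_returnTime k)
    _ ≤ ∑' k : ℕ, q ^ k := ENNReal.tsum_le_tsum (M.chainLaw_avoid_le hq)
    _ = (1 - q)⁻¹ := ENNReal.tsum_geometric q

theorem meanCost_le {μ : ℕ → Fin M.R → ℝ} {K : ℝ≥0∞} (hK : K ≠ ∞)
    (h : ∀ x, M.cost x (μ x) ≤ K) : M.meanCost μ ≤ K * M.meanReturn μ := by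
  rw [meanReturn, ← lintegral_const_mul' _ _ hK]
  refine lintegral_mono fun ω => ?_
  rw [← tsum_indicator_lt, ← ENNReal.tsum_mul_left]
  refine ENNReal.tsum_le_tsum fun k => ?_
  by_cases hk : (k : ℕ∞) < returnTime ω <;> simp [hk, h]

theorem exists_meanReturn_le :
    ∃ N : ℝ≥0, ∀ μ : ℕ → Fin M.R → ℝ, M.Feasible μ → M.meanReturn μ ≤ N := by
  obtain ⟨Λ, hΛ⟩ := M.exists_rate_le
  have hδ : ENNReal.ofReal (Real.exp (-Λ)) ≠ 0 := by simpa using Real.exp_pos _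
  have hδ1 : ENNReal.ofReal (Real.exp (-Λ)) ≤ 1 := by simp
  refine ⟨(ENNReal.ofReal (Real.exp (-Λ)))⁻¹.toNNReal, fun μ hμ => ?_⟩
  rw [ENNReal.coe_toNNReal (ENNReal.inv_ne_top.2 hδ)]
  have := M.meanReturn_le fun x => M.step_compl_zero_le (hΛ x (μ x) (hμ x))
  rwa [ENNReal.sub_sub_cancel ENNReal.one_ne_top hδ1] at this

end PricingMDP

end CongestionPricing

theorem proposition2 (M : CongestionPricing.PricingMDP) :
    (∀ μ : ℕ → Fin M.R → ℝ, M.Feasible μ → M.meanCost μ < ⊤ ∧ M.meanReturn μ < ⊤) ∧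
    ∃ Nbar : ℝ, 0 < Nbar ∧
      ∀ μ : ℕ → Fin M.R → ℝ, M.Feasible μ → M.meanReturn μ < ENNReal.ofReal Nbar := by
  obtain ⟨N, hN⟩ := M.exists_meanReturn_le
  obtain ⟨K, hK, hcost⟩ := M.exists_cost_le
  refine ⟨fun μ hμ => ?_, N + 1, by positivity, fun μ hμ => (hN μ hμ).trans_lt ?_⟩
  · have hfin := (hN μ hμ).trans_lt ENNReal.coe_lt_top
    exact ⟨(M.meanCost_le hK fun x => hcost x (μ x) (hμ x)).trans_lt
      (ENNReal.mul_lt_top hK.lt_top hfin), hfin⟩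
  · rw [← ENNReal.ofReal_coe_nnreal]
    exact (ENNReal.ofReal_lt_ofReal_iff (by positivity)).2 (lt_add_one _)
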